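/- Let $D=(V,A)$ be a finite digraph (parallel arcs allowed). For $U\subseteq V$ let $\delta^+(U)$ and $\delta^-(U)$ denote the sets of arcs leaving and entering $U$, respectively, and for $x\in\mathbb R^A$ and $B\subseteq A$ write $x(B)=\sum_{a\in B}x_a$. A dicut is an arc set $\delta^+(U)$ where $U\subset V$, $U\ne\emptyset$, $U\neq V$ and $\delta^-(U)=\emptyset$. The dijoin polyhedron of $D$ is $$\mathrm{dij}(D)=\{x\in\mathbb R^A : x\ge \mathbf 0,\ x(\delta^+(U))\ge 1 \text{ for every dicut } \delta^+(U)\}.$$ A digraft is a pair $(D,\mathcal F)$ where every node of $D$ is a source (no entering arcs) or a sink (no leaving arcs), the underlying undirected graph of $D$ is $2$-edge-connected (every nonempty proper subset of $V$ is joined to its complement by at least two edges), and $\mathcal F$ is a family of subsets of $V$ such that (a) $\emptyset,V\notin\mathcal F$; (b) $\delta^-(U)=\emptyset$ for every $U\in\mathcal F$; (c) $V\setminus\{v\}\in\mathcal F$ for every sink $v$ of $D$; and (d) the set $$F(D,\mathcal F)=\mathrm{dij}(D)\cap\{x\in\mathbb R^A : x(\delta^+(U))=1 \text{ for all } U\in\mathcal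 F\}$$ is nonempty. **Lemma 1.10 (Jump-Free Lemma).** Let $(D=(V,A),\mathcal F)$ be a digraft, let $\delta^+(U)$ be a dicut of $D$ (with $U$ as above), and let $x,y\in F(D,\mathcal F)\cap\{0,1\}^A$ be such that $\lambda_1:=x(\delta^+(U))<y(\delta^+(U))=:\lambda_2$. Then for every integer $\lambda$ with $\lambda_1<\lambda<\lambda_2$ there exists $z\in F(D,\mathcal F)\cap\{0,1\}^A$ such that $z(\delta^+(U))=\lambda$. -/

import Mathlib

/-- A directed multigraph with node set `V` and arc set `A` (parallel arcs are allowed):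
every arc has a tail and a head. -/
structure MultiDigraph (V A : Type*) where
  /-- the node that the arc leaves -/
  tail : A → V
  /-- the node that the arc enters -/
  head : A → V

namespace MultiDigraph

section

variable {V A : Type*} [Fintype V] [DecidableEq V] [Fintype A]

/-- `δ⁺(U)`: the set of arcs leaving `U`. -/
def outCut (D : MultiDigraph V A) (U : Finset V) : Finset A :=
  Finset.univ.filter fun a => D.tail a ∈ U ∧ D.head a ∉ U

/-- `δ⁻(U)`: the set of arcs entering `U`. -/
def inCut (D : MultiDigraph V A) (U : Finset V) : Finset A :=
  Finset.univ.filter fun a => D.tail a ∉ U ∧ D.head a ∈ U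

/-- A source: no arc has `v` as its head. -/
def IsSource (D : MultiDigraph V A) (v : V) : Prop := ∀ a, D.head a ≠ v

/-- A sink: no arc has `v` as its tail. -/
def IsSink (D : MultiDigraph V A) (v : V) : Prop := ∀ a, D.tail a ≠ v

/-- A digraph is bipartite if every node is a source or a sink. -/
def IsBipartite (D : MultiDigraph V A) : Prop := ∀ v, D.IsSource v ∨ D.IsSink v

/-- The underlying undirected graph is `2`-edge-connected: at least two edges, of either direction,
join every nonempty proper subset of the nodes to its complement. -/
def IsTwoEdgeConnected (D : MultiDigraph V A) : Prop :=
  ∀ U : Finset V, U ≠ ∅ → U ≠ Finset.univ → 2 ≤ (D.outCut U).card + (D.inCut U).card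

/-- `U` is the shore of a dicut `δ⁺(U)`: it is nonempty, proper, and no arc enters it. -/
def IsDicutShore (D : MultiDigraph V A) (U : Finset V) : Prop :=
  U ≠ ∅ ∧ U ≠ Finset.univ ∧ D.inCut U = ∅

/-- The dijoin polyhedron of `D`: `x ≥ 0` and `x(δ⁺(U)) ≥ 1` for every dicut `δ⁺(U)`. -/
def dijoinPolyhedron (D : MultiDigraph V A) : Set (A → ℝ) :=
  {x | (∀ U, D.IsDicutShore U → 1 ≤ ∑ a ∈ D.outCut U, x a) ∧ ∀ a, 0 ≤ x a}

/-- `F(D, 𝓕)`: the points `x` of the dijoin polyhedron with `x(δ⁺(U)) = 1` for all `U ∈ 𝓕`. -/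
def face (D : MultiDigraph V A) (𝓕 : Set (Finset V)) : Set (A → ℝ) :=
  D.dijoinPolyhedron ∩ {x | ∀ U ∈ 𝓕, ∑ a ∈ D.outCut U, x a = 1}

/-- The pair `(D, 𝓕)` is a digraft. -/
structure IsDigraft (D : MultiDigraph V A) (𝓕 : Set (Finset V)) : Prop where
  bipartite : D.IsBipartite
  twoEdgeConnected : D.IsTwoEdgeConnected
  empty_notMem : ∅ ∉ 𝓕
  univ_notMem : Finset.univ ∉ 𝓕
  inCut_eq_empty : ∀ U ∈ 𝓕, D.inCut U = ∅
  compl_sink_mem : ∀ v, D.IsSink v → ({v} : Finset V)ᶜ ∈ 𝓕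
  face_nonempty : (D.face 𝓕).Nonempty

end

end MultiDigraph

/-- The set `{0,1}^A` of `0,1` vectors, inside `ℝ^A`. -/
def zeroOneVectors (A : Type*) : Set (A → ℝ) :=
  {x | ∀ a, x a = 0 ∨ x a = 1}

/-! When no arc enters `W`, the value `x(δ⁺(W))` is the sum over `W` of the net outflow of `x`, so
the question can be moved from arc vectors to node vectors. The net outflows of `x` and `y` are
integral, have total `0`, are at least `1` on every dicut shore and equal `1` on `𝓕`. Dicut shores
form a crossing family, so an exchange property holds (`exists_exchange_face`): one unit can be
moved between two nodes, bringing `b` closer to `c` within the face. Each move changes the sum over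
`U` by at most `1`, so no integer is skipped. The vector found is lifted back to a `0,1` arc vector
by Hall's theorem (`exists_netOut_eq`). This needs the value `-1` at every sink, which condition (c)
forces. -/

section CrossingFamily

/-! ### Exchange properties over a crossing family. -/

variable {V : Type*} [DecidableEq V]

/-- If a family of sets is closed under unions of intersecting members, then an inequality between
two modular functions that holds on every member holds on the union of the family. -/
theorem Finset.sum_sup_le_sum_sup_of_union_mem (P : Finset (Finset V)) (b c : V → ℤ)
    (hP : ∀ X ∈ P, ∀ Y ∈ P, ¬ Disjoint X Y → X ∪ Y ∈ P)
    (h : ∀ X ∈ P, ∑ v ∈ X, c v ≤ ∑ v ∈ X, b v) :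
    ∑ v ∈ P.sup id, c v ≤ ∑ v ∈ P.sup id, b v := by
  classical
  -- Distinct maximal members are disjoint, so sums over the union split along them.
  let M := P.filter fun X => Maximal (· ∈ P) X
  have hsup : P.sup id = M.biUnion id := by
    ext v
    simp only [Finset.mem_sup, Finset.mem_biUnion, id]
    constructor
    · rintro ⟨X, hX, hv⟩
      obtain ⟨Y, hXY, hY⟩ := P.exists_le_maximal hX
      exact ⟨Y, Finset.mem_filter.2 ⟨hY.1, hY⟩, hXY hv⟩
    · rintro ⟨X, hX, hv⟩
      exact ⟨X, (Finset.mem_filter.1 hX).1, hv⟩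
  have hdisj : (M : Set (Finset V)).PairwiseDisjoint id := by
    intro X hX Y hY hne
    by_contra hd
    have hX' := (Finset.mem_filter.1 hX).2
    have hY' := (Finset.mem_filter.1 hY).2
    have hU := hP X hX'.1 Y hY'.1 hd
    have h1 : X ∪ Y = X := le_antisymm (hX'.2 hU Finset.subset_union_left) Finset.subset_union_left
    have h2 : X ∪ Y = Y :=
      le_antisymm (hY'.2 hU Finset.subset_union_right) Finset.subset_union_right
    exact hne (h1.symm.trans h2)
  rw [hsup, Finset.sum_biUnion hdisj, Finset.sum_biUnion hdisj]
  exact Finset.sum_le_sum fun X hX => h X (Finset.mem_filter.1 hX).1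

theorem Finset.sum_sub_single_add_single (b : V → ℤ) (u v : V) (W : Finset V) :
    ∑ i ∈ W, (b - Pi.single u 1 + Pi.single v 1 : V → ℤ) i =
      ∑ i ∈ W, b i - (if u ∈ W then 1 else 0) + (if v ∈ W then 1 else 0) := by
  simp [Finset.sum_add_distrib, Finset.sum_sub_distrib]

variable [Fintype V]

/-- A family of sets is crossing if it is closed under intersection and union of any two members
that intersect and do not cover the ground set. -/
def IsCrossingFamily (C : Set (Finset V)) : Prop :=
  ∀ X ∈ C, ∀ Y ∈ C, X ∩ Y ≠ ∅ → X ∪ Y ≠ Finset.univ → X ∩ Y ∈ C ∧ X ∪ Y ∈ C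

/-- The integral vectors of total `0` that are at least `1` on every member of `C`. -/
def crossingBases (C : Set (Finset V)) : Set (V → ℤ) :=
  {b | ∑ v, b v = 0 ∧ ∀ W ∈ C, 1 ≤ ∑ v ∈ W, b v}

/-- By uncrossing, the complements of the `b`-tight sets through `u` are closed under intersecting
unions, and `b` is `-1 ≥ c` on each. Hence `c ≤ b` in total on their union. If no `v` worked, that
union would contain every node with `b < c` but not `u`, and the total of `c` would be less than
that of `b`. -/
theorem IsCrossingFamily.exists_exchange {C : Set (Finset V)} (hC : IsCrossingFamily C)
    {b c : V → ℤ} (hb : b ∈ crossingBases C) (hc : c ∈ crossingBases C) {u : V} (hu : c u < b u) :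
    ∃ v, b v < c v ∧ ∀ W ∈ C, ∑ i ∈ W, b i = 1 → u ∈ W → v ∈ W := by
  classical
  obtain ⟨hb0, hb1⟩ := hb
  obtain ⟨hc0, hc1⟩ := hc
  let P : Finset (Finset V) :=
    Finset.univ.filter fun X => Xᶜ ∈ C ∧ ∑ i ∈ Xᶜ, b i = 1 ∧ u ∉ X
  have hPle : ∑ v ∈ P.sup id, c v ≤ ∑ v ∈ P.sup id, b v := by
    apply Finset.sum_sup_le_sum_sup_of_union_mem
    · intro X hX Y hY hd
      simp only [P, Finset.mem_filter, Finset.mem_univ, true_and] at hX hY ⊢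
      obtain ⟨hXC, hXb, hXu⟩ := hX
      obtain ⟨hYC, hYb, hYu⟩ := hY
      have hne : Xᶜ ∩ Yᶜ ≠ ∅ :=
        Finset.ne_empty_of_mem (a := u) (by simp [hXu, hYu])
      have hun : Xᶜ ∪ Yᶜ ≠ Finset.univ := by
        intro h
        apply hd
        rw [Finset.disjoint_iff_inter_eq_empty, ← Finset.compl_eq_univ_iff, Finset.compl_inter, h]
      obtain ⟨hI, hU⟩ := hC _ hXC _ hYC hne hun
      have hsum := Finset.sum_union_inter (s₁ := Xᶜ) (s₂ := Yᶜ) (f := b)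
      have hI1 := hb1 _ hI
      have hU1 := hb1 _ hU
      rw [Finset.compl_union]
      exact ⟨hI, by omega, by simp [hXu, hYu]⟩
    · intro X hX
      simp only [P, Finset.mem_filter, Finset.mem_univ, true_and] at hX
      have h1 := hc1 _ hX.1
      have h2 := Finset.sum_add_sum_compl X b
      have h3 := Finset.sum_add_sum_compl X c
      omega
  by_contra! hno
  have hlt : ∑ v ∈ (P.sup id)ᶜ, c v < ∑ v ∈ (P.sup id)ᶜ, b v := by
    apply Finset.sum_lt_sum
    · intro v hv
      by_contra! hlt
      obtain ⟨W, hW, hW1, huW, hvW⟩ := hno v hlt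
      apply Finset.mem_compl.1 hv
      rw [Finset.mem_sup]
      exact ⟨Wᶜ, by simp [P, hW, hW1, huW], by simpa using hvW⟩
    · refine ⟨u, ?_, hu⟩
      rw [Finset.mem_compl, Finset.mem_sup]
      rintro ⟨X, hX, huX⟩
      simp only [P, Finset.mem_filter, Finset.mem_univ, true_and] at hX
      exact hX.2.2 huX
  have h2 := Finset.sum_add_sum_compl (P.sup id) b
  have h3 := Finset.sum_add_sum_compl (P.sup id) c
  omega

/-- Exchange inside the face of `crossingBases C` on which all members of `𝓕` are tight. -/
theorem IsCrossingFamily.exists_exchange_face {C 𝓕 : Set (Finset V)} (hC : IsCrossingFamily C)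
    (h𝓕 : 𝓕 ⊆ C) {b c : V → ℤ} (hb : b ∈ crossingBases C) (hc : c ∈ crossingBases C)
    (hb𝓕 : ∀ W ∈ 𝓕, ∑ v ∈ W, b v = 1) (hc𝓕 : ∀ W ∈ 𝓕, ∑ v ∈ W, c v = 1) (hne : b ≠ c) :
    ∃ u v, c u < b u ∧ b v < c v ∧ b - Pi.single u 1 + Pi.single v 1 ∈ crossingBases C ∧
      ∀ W ∈ 𝓕, ∑ i ∈ W, (b - Pi.single u 1 + Pi.single v 1 : V → ℤ) i = 1 := by
  classical
  let G : V → Finset (Finset V) := fun v => Finset.univ.filter fun W => W ∈ 𝓕 ∧ v ∈ W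
  have hpos : (Finset.univ.filter fun u => c u < b u).Nonempty := by
    by_contra! h
    have hle : ∀ i ∈ Finset.univ, b i ≤ c i := by
      intro i _
      by_contra! hi
      have : i ∈ Finset.univ.filter fun u => c u < b u := by simp [hi]
      simp [h] at this
    have := (Finset.sum_eq_sum_iff_of_le hle).1 (hb.1.trans hc.1.symm)
    exact hne (funext fun i => this i (Finset.mem_univ i))
  -- Exchanging from `u` to `v`, then back from `v` to `w`, only enlarges the set of members of `𝓕`
  -- through the node. Maximality at `u` makes these sets equal, so the move from `u` to `v` keeps
  -- `𝓕` tight.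
  obtain ⟨u, hu, hmax⟩ := Finset.exists_max_image _ (fun u => (G u).card) hpos
  simp only [Finset.mem_filter, Finset.mem_univ, true_and] at hu hmax
  obtain ⟨v, hv, huv⟩ := hC.exists_exchange hb hc hu
  obtain ⟨w, hw, hvw⟩ := hC.exists_exchange hc hb hv
  have h1 : G u ⊆ G v := by
    intro W hW
    simp only [G, Finset.mem_filter, Finset.mem_univ, true_and] at hW ⊢
    exact ⟨hW.1, huv W (h𝓕 hW.1) (hb𝓕 W hW.1) hW.2⟩
  have h2 : G v ⊆ G w := by
    intro W hW
    simp only [G, Finset.mem_filter, Finset.mem_univ, true_and] at hW ⊢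
    exact ⟨hW.1, hvw W (h𝓕 hW.1) (hc𝓕 W hW.1) hW.2⟩
  have heq : G u = G v :=
    Finset.eq_of_subset_of_card_le h1 ((Finset.card_le_card h2).trans (hmax w hw))
  refine ⟨u, v, hu, hv, ⟨?_, ?_⟩, ?_⟩
  · rw [Finset.sum_sub_single_add_single]
    simp [hb.1]
  · intro W hW
    rw [Finset.sum_sub_single_add_single]
    have h3 := hb.2 W hW
    have h4 := huv W hW
    -- The sum drops only if `W` contains `u` and not `v`; such a `W` is not tight, so by
    -- integrality its sum is at least `2`.
    by_cases huW : u ∈ W <;> by_cases hvW : v ∈ W <;> simp only [huW, hvW, if_true, if_false] <;>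
      first
      | omega
      | (have : ∑ i ∈ W, b i ≠ 1 := fun h => hvW (h4 h huW)
         omega)
  · intro W hW
    rw [Finset.sum_sub_single_add_single, hb𝓕 W hW]
    have : u ∈ W ↔ v ∈ W := by
      have := congrArg (W ∈ ·) heq
      simpa [G, hW] using this
    by_cases hvW : v ∈ W <;> simp [this, hvW]

/-- Induction on the `ℓ¹` distance from `b` to `c`. Keeping the coordinates where `b` and `c` agree
preserves the value `-1` at sinks. -/
theorem IsCrossingFamily.exists_sum_eq {C 𝓕 : Set (Finset V)} (hC : IsCrossingFamily C)
    (h𝓕 : 𝓕 ⊆ C) (X : Finset V) (l : ℤ) {b c : V → ℤ}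
    (hb : b ∈ crossingBases C) (hc : c ∈ crossingBases C)
    (hb𝓕 : ∀ W ∈ 𝓕, ∑ v ∈ W, b v = 1) (hc𝓕 : ∀ W ∈ 𝓕, ∑ v ∈ W, c v = 1)
    (hbl : ∑ v ∈ X, b v < l) (hlc : l < ∑ v ∈ X, c v) :
    ∃ z ∈ crossingBases C, (∀ W ∈ 𝓕, ∑ v ∈ W, z v = 1) ∧ (∀ v, b v = c v → z v = b v) ∧
      ∑ v ∈ X, z v = l := by
  induction hn : ∑ v, (b v - c v).natAbs using Nat.strong_induction_on generalizing b with
  | _ n ih =>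
    have hne : b ≠ c := by
      rintro rfl
      omega
    obtain ⟨u, v, hu, hv, hb', hb𝓕'⟩ := hC.exists_exchange_face h𝓕 hb hc hb𝓕 hc𝓕 hne
    have huv : u ≠ v := by
      rintro rfl
      omega
    have hsum := Finset.sum_sub_single_add_single b u v X
    have heval : ∀ i, (b - Pi.single u 1 + Pi.single v 1 : V → ℤ) i =
        b i - (if i = u then 1 else 0) + (if i = v then 1 else 0) := by
      intro i
      simp [Pi.single_apply]
    generalize b - Pi.single u 1 + Pi.single v 1 = b' at hb' hb𝓕' hsum heval
    have hfix : ∀ i, b i = c i → b' i = b i := by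
      intro i hi
      have h1 : i ≠ u := by
        rintro rfl
        omega
      have h2 : i ≠ v := by
        rintro rfl
        omega
      simp [heval, h1, h2]
    have hle : ∑ i ∈ X, b' i ≤ l := by
      rw [hsum]
      split_ifs <;> omega
    rcases hle.lt_or_eq with hlt | heq
    · have hdec : ∑ i, (b' i - c i).natAbs < n := by
        rw [← hn]
        apply Finset.sum_lt_sum
        · intro i _
          rw [heval]
          by_cases h1 : i = u
          · subst h1
            simp only [huv, if_true, if_false]
            omega
          · by_cases h2 : i = v
            · subst h2
              simp only [h1, if_true, if_false]
              omega
            · simp [h1, h2]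
        · refine ⟨u, Finset.mem_univ u, ?_⟩
          rw [heval]
          simp only [huv, if_true, if_false]
          omega
      obtain ⟨z, hz, hz𝓕, hzfix, hzX⟩ := ih _ hdec hb' hb𝓕' hlt rfl
      exact ⟨z, hz, hz𝓕, fun i hi => (hzfix i ((hfix i hi).trans hi)).trans (hfix i hi), hzX⟩
    · exact ⟨b', hb', hb𝓕', hfix, heq⟩

end CrossingFamily

/-! ### Net outflows of `0,1` arc vectors. -/

namespace MultiDigraph

variable {V A : Type*} [DecidableEq V] [Fintype A]

/-- The net outflow of the arc vector `x` at each node. -/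
def netOut (D : MultiDigraph V A) (x : A → ℤ) (v : V) : ℤ :=
  ∑ a, x a * ((if D.tail a = v then 1 else 0) - (if D.head a = v then 1 else 0))

theorem sum_netOut (D : MultiDigraph V A) (x : A → ℤ) (W : Finset V) :
    ∑ v ∈ W, D.netOut x v = ∑ a ∈ D.outCut W, x a - ∑ a ∈ D.inCut W, x a := by
  unfold netOut outCut inCut
  rw [Finset.sum_comm, Finset.sum_filter, Finset.sum_filter, ← Finset.sum_sub_distrib]
  refine Finset.sum_congr rfl fun a _ => ?_
  rw [← Finset.mul_sum, Finset.sum_sub_distrib, Finset.sum_ite_eq, Finset.sum_ite_eq]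
  by_cases h1 : D.tail a ∈ W <;> by_cases h2 : D.head a ∈ W <;> simp [h1, h2]

theorem sum_netOut_of_inCut_eq_empty (D : MultiDigraph V A) (x : A → ℤ) {W : Finset V}
    (hW : D.inCut W = ∅) : ∑ v ∈ W, D.netOut x v = ∑ a ∈ D.outCut W, x a := by
  simp [sum_netOut, hW]

theorem inCut_eq_empty_iff (D : MultiDigraph V A) (W : Finset V) :
    D.inCut W = ∅ ↔ ∀ a, D.head a ∈ W → D.tail a ∈ W := by
  simp only [inCut, Finset.filter_eq_empty_iff, Finset.mem_univ, true_implies]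
  exact forall_congr' fun a => by tauto

variable [Fintype V]

theorem isCrossingFamily_isDicutShore (D : MultiDigraph V A) :
    IsCrossingFamily {W | D.IsDicutShore W} := by
  rintro X ⟨hX0, hX1, hX⟩ Y ⟨hY0, hY1, hY⟩ hI hU
  rw [inCut_eq_empty_iff] at hX hY
  refine ⟨⟨hI, ?_, ?_⟩, ⟨?_, hU, ?_⟩⟩
  · intro h
    exact hX1 (Finset.univ_subset_iff.1 (h ▸ Finset.inter_subset_left))
  · rw [inCut_eq_empty_iff]
    intro a ha
    rw [Finset.mem_inter] at ha ⊢
    exact ⟨hX a ha.1, hY a ha.2⟩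
  · intro h
    exact hX0 (Finset.subset_empty.1 (h ▸ Finset.subset_union_left))
  · rw [inCut_eq_empty_iff]
    intro a ha
    rw [Finset.mem_union] at ha ⊢
    exact ha.imp (hX a) (hY a)

/-- In a bipartite digraph, a vector that is `-1` at the sinks, has total `0`, and is nonnegative on
every set that no arc enters is the net outflow of a `0,1` vector. -/
theorem IsBipartite.exists_netOut_eq {D : MultiDigraph V A} (hD : D.IsBipartite) {b : V → ℤ}
    (hb0 : ∑ v, b v = 0) (hsink : ∀ v, D.IsSink v → b v = -1)
    (hb : ∀ W, D.inCut W = ∅ → 0 ≤ ∑ v ∈ W, b v) :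
    ∃ x : A → ℤ, (∀ a, x a = 0 ∨ x a = 1) ∧ D.netOut x = b := by
  classical
  have hnonneg : ∀ v, ¬ D.IsSink v → 0 ≤ b v := by
    intro v hv
    have hs := (hD v).resolve_right hv
    have := hb {v} ((D.inCut_eq_empty_iff _).2 fun a ha => absurd (Finset.mem_singleton.1 ha) (hs a))
    simpa using this
  -- Hall's theorem matches every sink, along an arc, to one of `b v` copies of a tail `v`; sinks
  -- have no copies, since `toNat` sends `-1` to `0`.
  let S := Σ v : V, Fin (b v).toNat
  let N : {v // D.IsSink v} → Finset S := fun t =>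
    Finset.univ.filter fun s => ∃ a, D.head a = t ∧ D.tail a = s.1
  have hall : ∀ T : Finset {v // D.IsSink v}, T.card ≤ (T.biUnion N).card := by
    intro T
    let X : Finset V := Finset.univ.filter fun v => ∃ t ∈ T, ∃ a, D.head a = t.1 ∧ D.tail a = v
    let Y : Finset V := T.map (Function.Embedding.subtype _)
    have hXY : Disjoint X Y := by
      rw [Finset.disjoint_left]
      intro v hv hv'
      simp only [X, Finset.mem_filter, Finset.mem_univ, true_and] at hv
      obtain ⟨t, _, a, _, ha⟩ := hv
      obtain ⟨s, _, rfl⟩ := Finset.mem_map.1 hv'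
      exact s.2 a ha
    -- Nodes of `X` are tails, hence sources, and all tails of arcs into `Y` lie in `X`;
    -- nonnegativity on `X ∪ Y` is then Hall's condition.
    have hcut : D.inCut (X ∪ Y) = ∅ := by
      rw [inCut_eq_empty_iff]
      intro a ha
      rcases Finset.mem_union.1 ha with h | h
      · simp only [X, Finset.mem_filter, Finset.mem_univ, true_and] at h
        obtain ⟨t, _, a', _, ha'⟩ := h
        rcases hD (D.head a) with h' | h'
        · exact absurd rfl (h' a)
        · exact absurd ha' (h' a')
      · obtain ⟨t, ht, hta⟩ := Finset.mem_map.1 h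
        apply Finset.mem_union_left
        simp only [X, Finset.mem_filter, Finset.mem_univ, true_and]
        exact ⟨t, ht, a, hta.symm, rfl⟩
    have h1 := hb _ hcut
    rw [Finset.sum_union hXY] at h1
    have hY : ∑ v ∈ Y, b v = -(T.card : ℤ) := by
      simp only [Y, Finset.sum_map, Function.Embedding.subtype_apply]
      rw [Finset.sum_congr rfl fun t _ => hsink t.1 t.2]
      simp
    have hN : T.biUnion N = X.sigma fun _ => Finset.univ := by
      ext s
      refine Iff.trans ?_ Finset.mem_sigma.symm
      simp only [N, X, Finset.mem_biUnion, Finset.mem_filter, Finset.mem_univ, true_and, and_true]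
    have hX : ∑ v ∈ X, b v ≤ ((T.biUnion N).card : ℤ) := by
      rw [hN, Finset.card_sigma]
      push_cast
      exact Finset.sum_le_sum fun v _ => by simp
    omega
  obtain ⟨f, hf, hfN⟩ := (Finset.all_card_le_biUnion_card_iff_exists_injective N).1 hall
  -- Total `0` makes the copies as numerous as the sinks, so every copy is used and each source
  -- sends out exactly `b v`.
  have hcard : Fintype.card {v // D.IsSink v} = Fintype.card S := by
    have h1 : (Fintype.card S : ℤ) = ∑ v, ((b v).toNat : ℤ) := by
      simp [S]
    have h2 : ∀ v, ((b v).toNat : ℤ) = b v + if D.IsSink v then 1 else 0 := by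
      intro v
      by_cases hv : D.IsSink v
      · simp [hv, hsink v hv]
      · simp [hv, hnonneg v hv]
    have h3 : (Fintype.card S : ℤ) = Fintype.card {v // D.IsSink v} := by
      rw [h1, Finset.sum_congr rfl fun v _ => h2 v, Finset.sum_add_distrib, hb0,
        Fintype.card_subtype]
      simp
    exact_mod_cast h3.symm
  have hbij : Function.Bijective f := (Fintype.bijective_iff_injective_and_card f).2 ⟨hf, hcard⟩
  have hex : ∀ t : {v // D.IsSink v}, ∃ a, D.head a = t ∧ D.tail a = (f t).1 := by
    intro t
    have := hfN t
    simpa [N] using this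
  choose g hg1 hg2 using hex
  have hginj : Function.Injective g := by
    intro s t hst
    apply Subtype.ext
    rw [← hg1 s, ← hg1 t, hst]
  refine ⟨fun a => if a ∈ Finset.univ.image g then 1 else 0, fun a => ?_, ?_⟩
  · by_cases h : a ∈ Finset.univ.image g
    · exact Or.inr (if_pos h)
    · exact Or.inl (if_neg h)
  · funext v
    unfold netOut
    simp only [ite_mul, one_mul, zero_mul]
    rw [Finset.sum_ite_mem, Finset.univ_inter, Finset.sum_image hginj.injOn,
      Finset.sum_sub_distrib]
    simp only [hg1, hg2]
    have h1 : ∑ t : {v // D.IsSink v}, (if (f t).1 = v then (1 : ℤ) else 0) = (b v).toNat := by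
      rw [hbij.sum_comp fun s : S => if s.1 = v then (1 : ℤ) else 0, Fintype.sum_sigma,
        Finset.sum_eq_single v]
      · simp
      · intro w _ hw
        simp [hw]
      · simp
    have h2 : ∑ t : {v // D.IsSink v}, (if (t : V) = v then (1 : ℤ) else 0) =
        if D.IsSink v then 1 else 0 := by
      split_ifs with hv
      · rw [Finset.sum_eq_single ⟨v, hv⟩]
        · simp
        · intro t _ ht
          exact if_neg fun h => ht (Subtype.ext h)
        · simp
      · refine Finset.sum_eq_zero fun t _ => if_neg ?_
        rintro rfl
        exact hv t.2
    rw [h1, h2]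
    by_cases hv : D.IsSink v
    · simp [hv, hsink v hv]
    · simp [hv, hnonneg v hv]

/-- A `0,1` vector in a face is integral, and its net outflow is a vector of the corresponding face
of the vectors that are at least `1` on all dicut shores. -/
theorem IsDigraft.exists_netOut {D : MultiDigraph V A} {𝓕 : Set (Finset V)} (hD : D.IsDigraft 𝓕)
    {x : A → ℝ} (hx : x ∈ D.face 𝓕 ∩ zeroOneVectors A) :
    ∃ b ∈ crossingBases {W | D.IsDicutShore W}, (∀ W ∈ 𝓕, ∑ v ∈ W, b v = 1) ∧
      (∀ v, D.IsSink v → b v = -1) ∧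
      ∀ W, D.inCut W = ∅ → ((∑ v ∈ W, b v : ℤ) : ℝ) = ∑ a ∈ D.outCut W, x a := by
  obtain ⟨⟨⟨hx1, -⟩, hx𝓕⟩, hx01⟩ := hx
  have hint : ∀ a, ∃ n : ℤ, (n : ℝ) = x a := by
    intro a
    rcases hx01 a with h | h
    · exact ⟨0, by simp [h]⟩
    · exact ⟨1, by simp [h]⟩
  choose y hy using hint
  have hsum : ∀ W, D.inCut W = ∅ →
      ((∑ v ∈ W, D.netOut y v : ℤ) : ℝ) = ∑ a ∈ D.outCut W, x a := by
    intro W hW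
    rw [D.sum_netOut_of_inCut_eq_empty y hW]
    push_cast
    exact Finset.sum_congr rfl fun a _ => hy a
  have htot : ∑ v, D.netOut y v = 0 := by
    rw [sum_netOut]
    simp [outCut, inCut]
  have hone : ∀ W ∈ 𝓕, ∑ v ∈ W, D.netOut y v = 1 := by
    intro W hW
    have := hsum W (hD.inCut_eq_empty W hW)
    rw [hx𝓕 W hW] at this
    exact_mod_cast this
  refine ⟨D.netOut y, ⟨htot, ?_⟩, hone, ?_, hsum⟩
  · intro W hW
    have := hsum W hW.2.2
    have h1 := hx1 W hW
    rw [← this] at h1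
    exact_mod_cast h1
  · intro v hv
    have h1 := hone _ (hD.compl_sink_mem v hv)
    have h2 := Finset.sum_add_sum_compl {v} (D.netOut y)
    rw [htot, h1, Finset.sum_singleton] at h2
    omega

end MultiDigraph

/-! ### The Jump-Free Lemma. -/

theorem lemma1p10 {V A : Type*} [Fintype V] [DecidableEq V] [Fintype A]
    (D : MultiDigraph V A) (𝓕 : Set (Finset V)) (hD : D.IsDigraft 𝓕)
    (U : Finset V) (hU : D.IsDicutShore U)
    (x y : A → ℝ) (hx : x ∈ D.face 𝓕 ∩ zeroOneVectors A) (hy : y ∈ D.face 𝓕 ∩ zeroOneVectors A)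
    (hxy : ∑ a ∈ D.outCut U, x a < ∑ a ∈ D.outCut U, y a)
    (l : ℤ) (hxl : ∑ a ∈ D.outCut U, x a < (l : ℝ)) (hly : (l : ℝ) < ∑ a ∈ D.outCut U, y a) :
    ∃ z ∈ D.face 𝓕 ∩ zeroOneVectors A, ∑ a ∈ D.outCut U, z a = (l : ℝ) := by
  obtain ⟨b, hb, hb𝓕, hbs, hbx⟩ := hD.exists_netOut hx
  obtain ⟨c, hc, hc𝓕, hcs, hcy⟩ := hD.exists_netOut hy
  rw [← hbx U hU.2.2] at hxl
  rw [← hcy U hU.2.2] at hly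
  have h𝓕 : 𝓕 ⊆ {W | D.IsDicutShore W} := fun W hW =>
    ⟨fun h => hD.empty_notMem (h ▸ hW), fun h => hD.univ_notMem (h ▸ hW), hD.inCut_eq_empty W hW⟩
  obtain ⟨d, ⟨hd0, hd1⟩, hd𝓕, hdfix, hdU⟩ := D.isCrossingFamily_isDicutShore.exists_sum_eq h𝓕 U l
    hb hc hb𝓕 hc𝓕 (by exact_mod_cast hxl) (by exact_mod_cast hly)
  have hdnonneg : ∀ W, D.inCut W = ∅ → 0 ≤ ∑ v ∈ W, d v := by
    intro W hW
    by_cases h0 : W = ∅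
    · simp [h0]
    by_cases h1 : W = Finset.univ
    · rw [h1, hd0]
    exact zero_le_one.trans (hd1 W ⟨h0, h1, hW⟩)
  obtain ⟨z, hz01, rfl⟩ := hD.bipartite.exists_netOut_eq hd0
    (fun v hv => (hdfix v ((hbs v hv).trans (hcs v hv).symm)).trans (hbs v hv)) hdnonneg
  have hsum : ∀ W, D.inCut W = ∅ →
      ∑ a ∈ D.outCut W, (z a : ℝ) = ((∑ v ∈ W, D.netOut z v : ℤ) : ℝ) := by
    intro W hW
    rw [D.sum_netOut_of_inCut_eq_empty z hW]
    push_cast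
    rfl
  refine ⟨fun a => z a, ⟨⟨⟨fun W hW => ?_, fun a => ?_⟩, fun W hW => ?_⟩, fun a => ?_⟩, ?_⟩
  · rw [hsum W hW.2.2]
    exact_mod_cast hd1 W hW
  · rcases hz01 a with h | h <;> simp [h]
  · rw [hsum W (hD.inCut_eq_empty W hW), hd𝓕 W hW, Int.cast_one]
  · rcases hz01 a with h | h <;> simp [h]
  · rw [hsum U hU.2.2, hdU]
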